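/- Let $n\ge 3$, let $\Omega\subset\mathbb S^n\subset\mathbb R^{n+1}$ be an open set (for instance a domain), and let $g_0$ be the standard metric of $\mathbb S^n$. Let $\mathbb L^{n+2}=\mathbb R\times\mathbb R^{n+1}$ carry the Lorentzian product $\langle\bar x,\bar y\rangle=-x_0y_0+\sum_{i=1}^{n+1}x_iy_i$, and let $\mathbb H^{n+1}=\{\bar x:\langle\bar x,\bar x\rangle=-1,\ x_0>0\}$. Let $T$ be an isometry of $\mathbb H^{n+1}$, that is, the restriction of a linear isometry $T$ of $\mathbb L^{n+2}$ preserving $\mathbb H^{n+1}$, and let $\Phi$ be the conformal diffeomorphism of $\mathbb S^n$ associated with it, i.e. $T(1,x)=e^{-\omega(x)}(1,\Phi(x))$ for all $x\in\mathbb S^n$ and some function $\omega$. A map $\phi:\Omega\to\mathbb H^{n+1}$ parametrized by its hyperbolic Gauss map is called $T$-invariant if $T(\phi(x))=\phi(\Phi(x))$ for all $x\in\Omega$ with $\Phi(x)\in\Omega$. A conformal metric $g=e^{2\rho}g_0$ on $\Omega$ is called $\Phi$-invariant if $g_x(u,v)=(\Phi^*g)_x(u,v)$ for all $x\in\Omega$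 with $\Phi(x)\in\Omega$ and all $u,v\in T_x\mathbb S^n$. For an oriented immersed hypersurface $\phi:\Omega\to\mathbb H^{n+1}$ with unit normal $\eta$, put $\psi=\phi+\eta$. The horospherical support function $e^{\rho}$ and the hyperbolic Gauss map $G:\Omega\to\mathbb S^n$ are defined by $\psi=e^{\rho}(1,G)$. The hypersurface is horospherically convex at $p$ if, near $p$, it meets the horosphere $\mathcal H_p=\{y\in\mathbb H^{n+1}:\langle y,\psi(p)\rangle=-1\}$ (tangent to it at $p$, with inner normal $\eta(p)$) only at $p$, and its signed distance to $\mathcal H_p$ does not vanish up to second order at $p$ in any direction. **(1)** Let $\phi:\Omega\to\mathbb H^{n+1}$ be a smooth oriented immersed hypersurface that is horospherically convex at every point, with hyperbolic Gauss map $G(x)=x$ and horospherical support function $e^{\rho}$, and let $g=e^{2\rho}g_0$ be its horospherical metric. If $\phi$ is $T$-invariant, then $g$ is $\Phi$-invariant. **(2)** Conversely, let $g=e^{2\rho}g_0$ be a smooth conformal metric on $\Omega$ such that at every point of $\Omega$ all eigenvalues of $g^{-1}\mathrm{Sch}_g$ are less than $\tfrac12$, where $\mathrm{Sch}_g=\frac1{n-2}\big(\mathrm{Ric}_g-\frac{S(g)}{2(n-1)}g\big)$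 is the Schouten tensor ($S(g)$ being the scalar curvature). If $g$ is $\Phi$-invariant, then the map $$\phi(x)=\frac{e^{\rho}}{2}\Big(1+e^{-2\rho}\big(1+\|\nabla^{g_0}\rho\|_{g_0}^2\big)\Big)(1,x)+e^{-\rho}\,(0,-x+\nabla^{g_0}\rho),\qquad x\in\Omega,$$ is $T$-invariant. -/

import Mathlib

open scoped Manifold ContDiff Topology

noncomputable section

namespace HoroConvex

/-! ### The round sphere and Lorentz-Minkowski space -/

/-- The Euclidean space `ℝ^{n+1}`. -/
abbrev Euc (n : ℕ) : Type := EuclideanSpace ℝ (Fin (n + 1))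

/-- The unit sphere `S^n` in `ℝ^{n+1}`, with Mathlib's manifold structure. -/
abbrev Sph (n : ℕ) : Type := Metric.sphere (0 : Euc n) 1

/-- The vector space underlying the Lorentz-Minkowski space `L^{n+2}`: pairs `(x₀, (x₁, …, x_{n+1}))`.
(The product norm on it is used only for its topology and smooth structure.) -/
abbrev Lor (n : ℕ) : Type := ℝ × Euc n

variable {n : ℕ}

/-- The Lorentzian scalar product `- x₀ y₀ + x₁ y₁ + ⋯ + x_{n+1} y_{n+1}`. -/
def lorentz (v w : Lor n) : ℝ := -(v.1 * w.1) + inner ℝ v.2 w.2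

/-- The hyperbolic space `H^{n+1}` (hyperboloid model). -/
def hyperbolicSpace (n : ℕ) : Set (Lor n) := {v | lorentz v v = -1 ∧ 0 < v.1}

/-- The differential at `x` of the inclusion `S^n → ℝ^{n+1}`; it identifies `T_x S^n` with `x^⊥`. -/
def tangentIncl (x : Sph n) : TangentSpace (𝓡 n) x →L[ℝ] Euc n :=
  mvfderiv (𝓡 n) (Subtype.val : Sph n → Euc n) x

/-- The standard metric `g₀` of `S^n`. -/
def roundMetric (x : Sph n) (u v : TangentSpace (𝓡 n) x) : ℝ :=
  inner ℝ (tangentIncl x u) (tangentIncl x v)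

/-- The conformal metric `g = e^{2ρ} g₀`. -/
def conformalMetric (ρ : Sph n → ℝ) (x : Sph n) (u v : TangentSpace (𝓡 n) x) : ℝ :=
  Real.exp (2 * ρ x) * roundMetric x u v

/-- The differential of a real-valued function on the sphere. -/
def sphDiff (ρ : Sph n → ℝ) (x : Sph n) : TangentSpace (𝓡 n) x →L[ℝ] ℝ :=
  mvfderiv (𝓡 n) ρ x

/-- Existence and uniqueness of the gradient of a function with respect to `g₀`. -/
theorem existsUnique_gradient (ρ : Sph n → ℝ) (x : Sph n) :
    ∃! w : TangentSpace (𝓡 n) x, ∀ u, roundMetric x w u = sphDiff ρ x u := by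
  have := Fact.mk (@finrank_euclideanSpace_fin ℝ _ (n + 1))
  have hinj : Function.Injective (tangentIncl x) := injective_mvfderiv_subtypeVal_sphere x
  have : FiniteDimensional ℝ (TangentSpace (𝓡 n) x) :=
    inferInstanceAs (FiniteDimensional ℝ (EuclideanSpace ℝ (Fin n)))
  let B : TangentSpace (𝓡 n) x →ₗ[ℝ] Module.Dual ℝ (TangentSpace (𝓡 n) x) :=
    (innerₗ (Euc n)).compl₁₂ (tangentIncl x).toLinearMap (tangentIncl x).toLinearMap
  have hB : ∀ w u, B w u = roundMetric x w u := fun w u => rfl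
  have hBinj : Function.Injective B := by
    rw [injective_iff_map_eq_zero]
    intro w hw
    have h0 : roundMetric x w w = 0 := by rw [← hB, hw]; rfl
    have h1 : tangentIncl x w = 0 := inner_self_eq_zero.mp h0
    exact hinj (h1.trans (map_zero _).symm)
  have hBsurj : Function.Surjective B :=
    (LinearMap.injective_iff_surjective_of_finrank_eq_finrank
      (Subspace.dual_finrank_eq (K := ℝ) (V := TangentSpace (𝓡 n) x)).symm).mp hBinj
  obtain ⟨w, hw⟩ := hBsurj (sphDiff ρ x).toLinearMap
  refine ⟨w, fun u => ?_, fun w' hw' => hBinj ?_⟩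
  · rw [← hB, hw]; rfl
  · ext u
    rw [hB, hw', hw]; rfl

/-- The gradient `∇^{g₀} ρ` at `x`, as a vector of `ℝ^{n+1}` tangent to `S^n` at `x`. -/
def sphGradient (ρ : Sph n → ℝ) (x : Sph n) : Euc n :=
  tangentIncl x (existsUnique_gradient ρ x).choose

/-! ### Conformal diffeomorphisms, Lorentz isometries and their correspondence -/

/-- A diffeomorphism `Φ` of `S^n` is conformal: `Φ^* g₀ = e^{2τ} g₀` for some function `τ`. -/
def IsConformalDiffeo (Φ : Diffeomorph (𝓡 n) (𝓡 n) (Sph n) (Sph n) ∞) : Prop :=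
  ∃ τ : Sph n → ℝ, ∀ (x : Sph n) (u v : TangentSpace (𝓡 n) x),
    roundMetric (Φ x) (mfderiv (𝓡 n) (𝓡 n) Φ x u) (mfderiv (𝓡 n) (𝓡 n) Φ x v) =
      Real.exp (2 * τ x) * roundMetric x u v

/-- `T` is a linear isometry of `L^{n+2}` that preserves `H^{n+1}`. The isometries of `H^{n+1}` are
exactly the restrictions to `H^{n+1}` of such maps. -/
def IsHyperbolicIsometry (T : Lor n ≃ₗ[ℝ] Lor n) : Prop :=
  (∀ v w, lorentz (T v) (T w) = lorentz v w) ∧ ∀ v ∈ hyperbolicSpace n, T v ∈ hyperbolicSpace n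

/-- `T` and `Φ` are associated: `Φ` is the action of `T` on the sphere
`S^n = {(1, x)}` of rays of the future null cone, `T (1, x) = e^{-τ(x)} (1, Φ x)`. -/
def AreAssociated (T : Lor n ≃ₗ[ℝ] Lor n) (Φ : Diffeomorph (𝓡 n) (𝓡 n) (Sph n) (Sph n) ∞) : Prop :=
  ∃ τ : Sph n → ℝ, ∀ x : Sph n,
    T ((1, (x : Euc n)) : Lor n) = Real.exp (-τ x) • ((1, (Φ x : Euc n)) : Lor n)

/-- `g = e^{2ρ} g₀` on `Ω` is `Φ`-invariant: `g_x(u, v) = (Φ^* g)_x(u, v)` for all `x ∈ Ω` with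
`Φ x ∈ Ω` and all `u, v` tangent to `S^n` at `x`. -/
def IsMetricInvariant (Ω : Set (Sph n)) (ρ : Sph n → ℝ)
    (Φ : Diffeomorph (𝓡 n) (𝓡 n) (Sph n) (Sph n) ∞) : Prop :=
  ∀ x ∈ Ω, Φ x ∈ Ω → ∀ u v : TangentSpace (𝓡 n) x,
    conformalMetric ρ x u v =
      conformalMetric ρ (Φ x) (mfderiv (𝓡 n) (𝓡 n) Φ x u) (mfderiv (𝓡 n) (𝓡 n) Φ x v)

/-- `φ : Ω → H^{n+1}` is `T`-invariant through the diffeomorphism `i` of `S^n`: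
`T (φ p) = φ (i p)` for all `p ∈ Ω` with `i p ∈ Ω`. -/
def IsInvariantThrough (Ω : Set (Sph n)) (φ : Sph n → Lor n) (T : Lor n ≃ₗ[ℝ] Lor n)
    (i : Diffeomorph (𝓡 n) (𝓡 n) (Sph n) (Sph n) ∞) : Prop :=
  ∀ p ∈ Ω, i p ∈ Ω → T (φ p) = φ (i p)

/-! ### Oriented hypersurfaces of hyperbolic space -/

/-- The differential at `x` of a map from the sphere to `L^{n+2}`. -/
def lorDiff (φ : Sph n → Lor n) (x : Sph n) : TangentSpace (𝓡 n) x →L[ℝ] Lor n :=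
  mvfderiv (𝓡 n) φ x

/-- On the open set `Ω`, `φ` is a smooth immersed hypersurface of `H^{n+1}` with unit normal `η`. -/
structure IsOrientedHypersurface (Ω : Set (Sph n)) (φ η : Sph n → Lor n) : Prop where
  smooth : ContMDiffOn (𝓡 n) 𝓘(ℝ, Lor n) ∞ φ Ω
  smooth_normal : ContMDiffOn (𝓡 n) 𝓘(ℝ, Lor n) ∞ η Ω
  mem : ∀ x ∈ Ω, φ x ∈ hyperbolicSpace n
  immersion : ∀ x ∈ Ω, Function.Injective (lorDiff φ x)
  normal_unit : ∀ x ∈ Ω, lorentz (η x) (η x) = 1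
  normal_tangent : ∀ x ∈ Ω, lorentz (η x) (φ x) = 0
  normal_orthogonal : ∀ x ∈ Ω, ∀ u, lorentz (η x) (lorDiff φ x u) = 0

/-- The associated light cone map `ψ = φ + η`. -/
def lightCone (φ η : Sph n → Lor n) (x : Sph n) : Lor n := φ x + η x

/-- The horospherical support function `ψ₀` (written `e^ρ`). -/
def supportFunction (φ η : Sph n → Lor n) (x : Sph n) : ℝ := (lightCone φ η x).1

/-- The hyperbolic Gauss map `G`, determined by `ψ = ψ₀ (1, G)`. -/
def gaussMap (φ η : Sph n → Lor n) (x : Sph n) : Euc n :=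
  (supportFunction φ η x)⁻¹ • (lightCone φ η x).2

/-- The horosphere whose inner unit normal `ν` satisfies `y + ν(y) = v` at all of its points `y`,
for `v` in the future null cone. -/
def horosphere (v : Lor n) : Set (Lor n) := {y ∈ hyperbolicSpace n | lorentz y v = -1}

/-- The signed hyperbolic distance from a point `y` of `H^{n+1}` to `horosphere v`. -/
def horosphereDist (v y : Lor n) : ℝ := Real.log (-lorentz y v)

/-- The oriented hypersurface `φ` (with unit normal `η`) is horospherically convex at `p`: near `p`,
it meets the horosphere `{⟨·, ψ(p)⟩ = -1}` that is tangent to it at `p` with the same inner normal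
only at `p`, and its distance to this horosphere does not vanish up to second order at `p` in any
direction. (The first derivatives at `p` vanish, by tangency.) -/
def IsHorosphericallyConvexAt (φ η : Sph n → Lor n) (p : Sph n) : Prop :=
  (∀ᶠ q in 𝓝[≠] p, φ q ∉ horosphere (lightCone φ η p)) ∧
  ∀ γ : ℝ → Sph n, ContMDiff 𝓘(ℝ, ℝ) (𝓡 n) ∞ γ → γ 0 = p →
    mfderiv 𝓘(ℝ, ℝ) (𝓡 n) γ 0 ≠ 0 →
      iteratedDeriv 2 (fun t => horosphereDist (lightCone φ η p) (φ (γ t))) 0 ≠ 0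

/-- The map attached to `ρ` by the representation formula
`φ = (e^ρ/2) (1 + e^{-2ρ} (1 + |∇ρ|²)) (1, x) + e^{-ρ} (0, -x + ∇ρ)`. -/
def representation (ρ : Sph n → ℝ) (x : Sph n) : Lor n :=
  (Real.exp (ρ x) / 2 * (1 + Real.exp (-2 * ρ x) * (1 + ‖sphGradient ρ x‖ ^ 2))) •
      ((1, (x : Euc n)) : Lor n) +
    Real.exp (-ρ x) • ((0, -(x : Euc n) + sphGradient ρ x) : Lor n)

/-! ### Curvature in a chart -/

/-- A metric in coordinates: the matrix `(g_{ij})` as a function on `ℝⁿ`. -/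
abbrev CoordMetric (n : ℕ) : Type := EuclideanSpace ℝ (Fin n) → Matrix (Fin n) (Fin n) ℝ

/-- The partial derivative `∂_i f` at `y`. -/
def pd (i : Fin n) (f : EuclideanSpace ℝ (Fin n) → ℝ) (y : EuclideanSpace ℝ (Fin n)) : ℝ :=
  fderiv ℝ f y (EuclideanSpace.single i 1)

/-- The Christoffel symbol `Γ^k_{ij}`. -/
def christoffel (g : CoordMetric n) (k i j : Fin n) (y : EuclideanSpace ℝ (Fin n)) : ℝ :=
  (1 / 2) * ∑ l, (g y)⁻¹ k l *
    (pd i (fun z => g z j l) y + pd j (fun z => g z i l) y - pd l (fun z => g z i j) y)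

/-- The Ricci tensor
`R_{ij} = ∂_k Γ^k_{ij} - ∂_j Γ^k_{ik} + Γ^k_{kl} Γ^l_{ij} - Γ^k_{jl} Γ^l_{ik}`. -/
def ricci (g : CoordMetric n) (y : EuclideanSpace ℝ (Fin n)) : Matrix (Fin n) (Fin n) ℝ :=
  Matrix.of fun i j =>
    (∑ k, (pd k (christoffel g k i j) y - pd j (christoffel g k i k) y)) +
      ∑ k, ∑ l, (christoffel g k k l y * christoffel g l i j y -
        christoffel g k j l y * christoffel g l i k y)

/-- The scalar curvature `g^{ij} R_{ij}`. -/
def scalarCurvature (g : CoordMetric n) (y : EuclideanSpace ℝ (Fin n)) : ℝ :=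
  ∑ i, ∑ j, (g y)⁻¹ i j * ricci g y i j

/-- The Schouten tensor `(1/(n-2)) (Ric - S/(2(n-1)) g)`, for `n ≥ 3`. -/
def schouten (g : CoordMetric n) (y : EuclideanSpace ℝ (Fin n)) : Matrix (Fin n) (Fin n) ℝ :=
  (1 / ((n : ℝ) - 2)) • (ricci g y - (scalarCurvature g y / (2 * ((n : ℝ) - 1))) • g y)

/-- The expression of a metric `g` on the sphere in the preferred chart at `x`. -/
def inChart (g : ∀ x : Sph n, TangentSpace (𝓡 n) x → TangentSpace (𝓡 n) x → ℝ) (x : Sph n) :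
    CoordMetric n := fun y =>
  Matrix.of fun i j =>
    g ((chartAt (EuclideanSpace ℝ (Fin n)) x).symm y)
      (mfderiv (𝓡 n) (𝓡 n) (chartAt (EuclideanSpace ℝ (Fin n)) x).symm y
        (EuclideanSpace.single i (1 : ℝ)))
      (mfderiv (𝓡 n) (𝓡 n) (chartAt (EuclideanSpace ℝ (Fin n)) x).symm y
        (EuclideanSpace.single j (1 : ℝ)))

/-- `c` is an eigenvalue at `x` of the Schouten tensor of `g`, that is, of the endomorphism
`g⁻¹ Sch_g` of the tangent space at `x`. -/
def IsSchoutenEigenvalue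
    (g : ∀ x : Sph n, TangentSpace (𝓡 n) x → TangentSpace (𝓡 n) x → ℝ) (x : Sph n) (c : ℝ) : Prop :=
  Module.End.HasEigenvalue
    (Matrix.toLin' ((inChart g x (chartAt (EuclideanSpace ℝ (Fin n)) x x))⁻¹ *
      schouten (inChart g x) (chartAt (EuclideanSpace ℝ (Fin n)) x x))) c

end HoroConvex

end

/-!
The light cone map `ψ(x) = e^{ρ(x)} (1, x)` carries the whole argument. Since `T` and `Φ` are
associated, `T (1, x) = c(x) (1, Φ x)` with `c = e^{-τ}`, so `T ψ(x) = ψ(Φ x)` amounts to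
`e^{ρ(x)} c(x) = e^{ρ(Φ x)}`. Differentiating `T (1, x) = c(x) (1, Φ x)` gives
`⟨u, v⟩ = c(x)² ⟨dΦ u, dΦ v⟩` (`HasConeFactor.roundMetric_eq_sq_mul`), so the scalar relation is
equivalent to the invariance of `g = e^{2ρ} g₀` (`HasConeFactor.isMetricInvariant_iff`).

In the direct implication, a hypersurface satisfies `⟨φ, ψ⟩ = -1`, that is
`⟨φ(x), (1, x)⟩ = -e^{-ρ(x)}`; applying the isometry `T` to this at `x` and comparing with the
same identity at `Φ x` yields the scalar relation.

In the converse implication, `φ(x)` is the only vector with `⟨φ, φ⟩ = -1`,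
`⟨φ, (1, x)⟩ = -e^{-ρ}` and `⟨φ, (0, u)⟩ = e^{-ρ} dρ(u)` for all `u` tangent at `x`
(`eq_of_lorentz_eq`): two vectors with the same products against `(1, x)` and all `(0, u)` differ by
a multiple of the null vector `(1, x)`, and the norm fixes the multiple. The differentiated
relations show that `T (φ x)` has the products that characterize `φ (Φ x)`.
-/

open scoped Manifold ContDiff Topology

noncomputable section

namespace HoroConvex

variable {n : ℕ}

/-! ### Tangent vectors of the sphere as vectors of Euclidean space -/

theorem mdifferentiableAt_coe_sph (x : Sph n) :
    MDifferentiableAt (𝓡 n) 𝓘(ℝ, Euc n) (Subtype.val : Sph n → Euc n) x := by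
  have := Fact.mk (@finrank_euclideanSpace_fin ℝ _ (n + 1))
  exact (contMDiff_coe_sphere (m := 1) x).mdifferentiableAt one_ne_zero

theorem range_tangentIncl (x : Sph n) :
    (tangentIncl x).range = (Submodule.span ℝ {(x : Euc n)})ᗮ := by
  have := Fact.mk (@finrank_euclideanSpace_fin ℝ _ (n + 1))
  exact range_mvfderiv_subtypeVal x

theorem tangentIncl_injective (x : Sph n) : Function.Injective (tangentIncl x) := by
  have := Fact.mk (@finrank_euclideanSpace_fin ℝ _ (n + 1))
  exact injective_mvfderiv_subtypeVal_sphere x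

theorem inner_coe_self (x : Sph n) : inner ℝ (x : Euc n) (x : Euc n) = 1 := by
  rw [real_inner_self_eq_norm_sq, norm_eq_of_mem_sphere x, one_pow]

theorem inner_coe_tangentIncl (x : Sph n) (u : TangentSpace (𝓡 n) x) :
    inner ℝ (x : Euc n) (tangentIncl x u) = 0 := by
  have h : tangentIncl x u ∈ (tangentIncl x).range := ⟨u, rfl⟩
  rw [range_tangentIncl] at h
  exact Submodule.mem_orthogonal_singleton_iff_inner_right.mp h

/-- A vector orthogonal to the tangent space of the sphere at `x` is a multiple of `x`. -/
theorem exists_eq_smul_of_inner_tangentIncl_eq_zero (x : Sph n) (v : Euc n)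
    (h : ∀ u, inner ℝ v (tangentIncl x u) = 0) : ∃ s : ℝ, v = s • (x : Euc n) := by
  have hv : v ∈ (Submodule.span ℝ {(x : Euc n)})ᗮᗮ := by
    rw [← range_tangentIncl, Submodule.mem_orthogonal']
    rintro _ ⟨u, rfl⟩
    exact h u
  rw [Submodule.orthogonal_orthogonal] at hv
  obtain ⟨s, hs⟩ := Submodule.mem_span_singleton.mp hv
  exact ⟨s, hs.symm⟩

theorem inner_sphGradient_tangentIncl (ρ : Sph n → ℝ) (x : Sph n) (u : TangentSpace (𝓡 n) x) :
    inner ℝ (sphGradient ρ x) (tangentIncl x u) = sphDiff ρ x u :=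
  (existsUnique_gradient ρ x).choose_spec.1 u

/-- In positive dimension the round metric is not identically zero at any point. -/
theorem exists_roundMetric_ne_zero (hn : 0 < n) (x : Sph n) :
    ∃ u, roundMetric x u u ≠ 0 := by
  have : Nonempty (Fin n) := ⟨⟨0, hn⟩⟩
  have : Nontrivial (TangentSpace (𝓡 n) x) :=
    inferInstanceAs (Nontrivial (EuclideanSpace ℝ (Fin n)))
  obtain ⟨u, hu⟩ := exists_ne (0 : TangentSpace (𝓡 n) x)
  refine ⟨u, fun h => hu (tangentIncl_injective x ?_)⟩
  rw [map_zero]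
  exact inner_self_eq_zero.mp h

/-! ### Chain rules -/

theorem mvfderiv_comp_sph {F : Type*} [NormedAddCommGroup F] [NormedSpace ℝ F]
    {f : Sph n → Sph n} {g : Sph n → F} (x : Sph n)
    (hg : MDifferentiableAt (𝓡 n) 𝓘(ℝ, F) g (f x)) (hf : MDifferentiableAt (𝓡 n) (𝓡 n) f x)
    (u : TangentSpace (𝓡 n) x) :
    mvfderiv (𝓡 n) (g ∘ f) x u = mvfderiv (𝓡 n) g (f x) (mfderiv (𝓡 n) (𝓡 n) f x u) :=
  mfderiv_comp_apply x hg hf u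

theorem mvfderiv_fderiv_comp {F F' : Type*} [NormedAddCommGroup F] [NormedSpace ℝ F]
    [NormedAddCommGroup F'] [NormedSpace ℝ F'] {f : Sph n → F} {g : F → F'} {g' : F →L[ℝ] F'}
    (x : Sph n) (hg : HasFDerivAt g g' (f x)) (hf : MDifferentiableAt (𝓡 n) 𝓘(ℝ, F) f x)
    (u : TangentSpace (𝓡 n) x) :
    mvfderiv (𝓡 n) (g ∘ f) x u = g' (mvfderiv (𝓡 n) f x u) := by
  have h : mfderiv (𝓡 n) 𝓘(ℝ, F') (g ∘ f) x = _ :=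
    (hg.hasMFDerivAt.comp x hf.hasMFDerivAt).mfderiv
  exact congrArg (fun L => L u) h

theorem sphDiff_exp {ρ : Sph n → ℝ} {x : Sph n} (hρ : MDifferentiableAt (𝓡 n) 𝓘(ℝ, ℝ) ρ x)
    (u : TangentSpace (𝓡 n) x) :
    sphDiff (fun z => Real.exp (ρ z)) x u = Real.exp (ρ x) * sphDiff ρ x u := by
  have h := mvfderiv_fderiv_comp x (Real.hasDerivAt_exp (ρ x)).hasFDerivAt hρ u
  refine h.trans ?_
  simp [sphDiff, mul_comm]

/-! ### Lorentzian algebra -/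

theorem lorentz_add_left (v v' w : Lor n) : lorentz (v + v') w = lorentz v w + lorentz v' w := by
  simp only [lorentz, Prod.fst_add, Prod.snd_add, inner_add_left]; ring

theorem lorentz_smul_left (a : ℝ) (v w : Lor n) : lorentz (a • v) w = a * lorentz v w := by
  simp only [lorentz, Prod.smul_fst, Prod.smul_snd, inner_smul_left, smul_eq_mul]
  simp; ring

theorem lorentz_comm (v w : Lor n) : lorentz v w = lorentz w v := by
  simp only [lorentz, real_inner_comm, mul_comm]

theorem lorentz_add_right (v w w' : Lor n) : lorentz v (w + w') = lorentz v w + lorentz v w' := by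
  rw [lorentz_comm, lorentz_add_left, lorentz_comm w, lorentz_comm w']

theorem lorentz_smul_right (a : ℝ) (v w : Lor n) : lorentz v (a • w) = a * lorentz v w := by
  rw [lorentz_comm, lorentz_smul_left, lorentz_comm]

/-- The null vector `(1, x)`, which represents `x` in the future light cone. -/
def nullVec (x : Sph n) : Lor n := (1, (x : Euc n))

/-- The tangent vector `u` of the sphere, as the vector `(0, u)` of `L^{n+2}`; this is the
differential of `nullVec`. -/
def nullTangent (x : Sph n) (u : TangentSpace (𝓡 n) x) : Lor n := (0, tangentIncl x u)

theorem lorentz_nullVec_self (x : Sph n) : lorentz (nullVec x) (nullVec x) = 0 := by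
  simp only [lorentz, nullVec, inner_coe_self]; norm_num

theorem lorentz_nullVec_nullTangent (x : Sph n) (u : TangentSpace (𝓡 n) x) :
    lorentz (nullVec x) (nullTangent x u) = 0 := by
  simp only [lorentz, nullVec, nullTangent, inner_coe_tangentIncl]; norm_num

theorem lorentz_nullTangent (x : Sph n) (u v : TangentSpace (𝓡 n) x) :
    lorentz (nullTangent x u) (nullTangent x v) = roundMetric x u v := by
  simp [lorentz, nullTangent, roundMetric]

/-- A vector with nonzero product against `(1, x)` is determined by its square and its products
against `(1, x)` and the tangent vectors `(0, u)`. -/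
theorem eq_of_lorentz_eq (x : Sph n) {V W : Lor n} (hself : lorentz V V = lorentz W W)
    (hne : lorentz W (nullVec x) ≠ 0) (hnull : lorentz V (nullVec x) = lorentz W (nullVec x))
    (htan : ∀ u, lorentz V (nullTangent x u) = lorentz W (nullTangent x u)) : V = W := by
  obtain ⟨s, hs⟩ := exists_eq_smul_of_inner_tangentIncl_eq_zero x (V.2 - W.2) fun u => by
    have h := htan u
    simp only [lorentz, nullTangent, mul_zero, neg_zero, zero_add] at h
    rw [inner_sub_left, h, sub_self]
  -- The difference `V - W` is orthogonal to `(1, x)`, so its time component is `s` too.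
  have hV : V = W + s • nullVec x := by
    have h2 : V.2 = W.2 + s • (x : Euc n) := by rw [← hs]; abel
    have h1 : V.1 = W.1 + s := by
      have h := hnull
      simp only [lorentz, nullVec, h2, inner_add_left, inner_smul_left, inner_coe_self] at h
      simp at h
      linarith
    refine Prod.ext ?_ ?_
    · simpa [nullVec] using h1
    · simpa [nullVec] using h2
  have h0 : s * lorentz W (nullVec x) = 0 := by
    rw [hV] at hself
    simp only [lorentz_add_left, lorentz_add_right, lorentz_smul_left, lorentz_smul_right,
      lorentz_nullVec_self, lorentz_comm (nullVec x) W] at hself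
    linarith
  rw [hV, (mul_eq_zero.mp h0).resolve_right hne, zero_smul, add_zero]

/-! ### The products that characterize the representation formula -/

theorem inner_coe_sphGradient (ρ : Sph n → ℝ) (x : Sph n) :
    inner ℝ (x : Euc n) (sphGradient ρ x) = 0 :=
  inner_coe_tangentIncl x _

theorem representation_eq (ρ : Sph n → ℝ) (x : Sph n) :
    representation ρ x =
      (Real.exp (ρ x) / 2 * (1 + Real.exp (-2 * ρ x) * (1 + ‖sphGradient ρ x‖ ^ 2))) • nullVec x +
        Real.exp (-ρ x) • ((0, -(x : Euc n) + sphGradient ρ x) : Lor n) := rfl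

theorem lorentz_representation_nullVec (ρ : Sph n → ℝ) (x : Sph n) :
    lorentz (representation ρ x) (nullVec x) = -Real.exp (-ρ x) := by
  rw [representation_eq, lorentz_add_left, lorentz_smul_left, lorentz_smul_left,
    lorentz_nullVec_self]
  simp [lorentz, nullVec, inner_add_left, real_inner_comm, inner_coe_sphGradient]

theorem lorentz_representation_nullTangent (ρ : Sph n → ℝ) (x : Sph n)
    (u : TangentSpace (𝓡 n) x) :
    lorentz (representation ρ x) (nullTangent x u) = Real.exp (-ρ x) * sphDiff ρ x u := by
  rw [representation_eq, lorentz_add_left, lorentz_smul_left, lorentz_smul_left,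
    lorentz_nullVec_nullTangent]
  simp [lorentz, nullTangent, inner_add_left, inner_coe_tangentIncl,
    inner_sphGradient_tangentIncl]

theorem lorentz_representation_self (ρ : Sph n → ℝ) (x : Sph n) :
    lorentz (representation ρ x) (representation ρ x) = -1 := by
  have hspace : lorentz ((0, -(x : Euc n) + sphGradient ρ x) : Lor n)
      (0, -(x : Euc n) + sphGradient ρ x) = 1 + ‖sphGradient ρ x‖ ^ 2 := by
    have h := inner_coe_sphGradient ρ x
    have h' : inner ℝ (sphGradient ρ x) (x : Euc n) = 0 := by rw [real_inner_comm, h]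
    simp only [lorentz, inner_add_left, inner_add_right, inner_neg_left, inner_neg_right,
      inner_coe_self, h, h', real_inner_self_eq_norm_sq (sphGradient ρ x)]
    ring
  have hmix : lorentz (nullVec x) ((0, -(x : Euc n) + sphGradient ρ x) : Lor n) = -1 := by
    simp [lorentz, nullVec, inner_add_right, inner_coe_sphGradient]
  have h1 : Real.exp (ρ x) * Real.exp (-ρ x) = 1 := by rw [← Real.exp_add]; simp
  have h2 : Real.exp (-2 * ρ x) = Real.exp (-ρ x) ^ 2 := by
    rw [← Real.exp_nat_mul]; congr 1; push_cast; ring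
  rw [representation_eq]
  simp only [lorentz_add_left, lorentz_add_right, lorentz_smul_left, lorentz_smul_right,
    lorentz_nullVec_self, hspace, hmix, h2,
    lorentz_comm ((0, -(x : Euc n) + sphGradient ρ x) : Lor n) (nullVec x)]
  linear_combination (-1 - Real.exp (-ρ x) ^ 2 * (1 + ‖sphGradient ρ x‖ ^ 2)) * h1

/-! ### The action of an isometry on the light cone -/

/-- `T` acts on the rays of the light cone by `Φ`, with factor `c`:
`T (1, x) = c(x) (1, Φ x)`, where `c` is positive. -/
def HasConeFactor (T : Lor n ≃ₗ[ℝ] Lor n) (Φ : Diffeomorph (𝓡 n) (𝓡 n) (Sph n) (Sph n) ∞)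
    (c : Sph n → ℝ) : Prop :=
  ∀ x, 0 < c x ∧ T (nullVec x) = c x • nullVec (Φ x)

theorem AreAssociated.exists_hasConeFactor {T : Lor n ≃ₗ[ℝ] Lor n}
    {Φ : Diffeomorph (𝓡 n) (𝓡 n) (Sph n) (Sph n) ∞} (h : AreAssociated T Φ) :
    ∃ c, HasConeFactor T Φ c := by
  obtain ⟨τ, hτ⟩ := h
  exact ⟨fun x => Real.exp (-τ x), fun x => ⟨Real.exp_pos _, hτ x⟩⟩

section ConeFactor

variable {T : Lor n ≃ₗ[ℝ] Lor n} {Φ : Diffeomorph (𝓡 n) (𝓡 n) (Sph n) (Sph n) ∞} {c : Sph n → ℝ}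

theorem diffeo_mdifferentiableAt (Φ : Diffeomorph (𝓡 n) (𝓡 n) (Sph n) (Sph n) ∞) (x : Sph n) :
    MDifferentiableAt (𝓡 n) (𝓡 n) Φ x :=
  Φ.contMDiff.mdifferentiable (by simp) x

theorem mdifferentiableAt_nullVec (x : Sph n) :
    MDifferentiableAt (𝓡 n) 𝓘(ℝ, Lor n) (nullVec : Sph n → Lor n) x :=
  mdifferentiableAt_const.prodMk_space (mdifferentiableAt_coe_sph x)

theorem lorDiff_nullVec (x : Sph n) (u : TangentSpace (𝓡 n) x) :
    lorDiff nullVec x u = nullTangent x u := by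
  have hg : HasFDerivAt (fun y : Euc n => ((1, y) : Lor n))
      ((0 : Euc n →L[ℝ] ℝ).prod (ContinuousLinearMap.id ℝ (Euc n))) (x : Euc n) :=
    (hasFDerivAt_const (1 : ℝ) _).prodMk (hasFDerivAt_id _)
  exact mvfderiv_fderiv_comp x hg (mdifferentiableAt_coe_sph x) u

theorem HasConeFactor.mdifferentiableAt (hc : HasConeFactor T Φ c) (x : Sph n) :
    MDifferentiableAt (𝓡 n) 𝓘(ℝ, ℝ) c x := by
  -- `c(z)` is the time component of `T (1, z)`.
  have h : c = fun z => ((ContinuousLinearMap.fst ℝ ℝ (Euc n)).comp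
      (LinearMap.toContinuousLinearMap (T : Lor n →ₗ[ℝ] Lor n))) (nullVec z) := by
    funext z
    change c z = (T (nullVec z)).1
    rw [(hc z).2]
    simp [nullVec]
  rw [h]
  exact (ContinuousLinearMap.mdifferentiableAt _).comp x (mdifferentiableAt_nullVec x)

/-- The differential of the relation `T (1, x) = c(x) (1, Φ x)`. -/
theorem HasConeFactor.map_nullTangent (hc : HasConeFactor T Φ c) (x : Sph n)
    (u : TangentSpace (𝓡 n) x) :
    T (nullTangent x u) = sphDiff c x u • nullVec (Φ x) +
      c x • nullTangent (Φ x) (mfderiv (𝓡 n) (𝓡 n) Φ x u) := by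
  have hT := mvfderiv_fderiv_comp x
    (LinearMap.toContinuousLinearMap (T : Lor n →ₗ[ℝ] Lor n)).hasFDerivAt
    (mdifferentiableAt_nullVec x) u
  have hfun : (LinearMap.toContinuousLinearMap (T : Lor n →ₗ[ℝ] Lor n)) ∘ nullVec =
      c • (nullVec ∘ Φ) := by
    funext z
    exact (hc z).2
  have hΦ : MDifferentiableAt (𝓡 n) 𝓘(ℝ, Lor n) ((nullVec : Sph n → Lor n) ∘ Φ) x :=
    (mdifferentiableAt_nullVec (Φ x)).comp x (diffeo_mdifferentiableAt Φ x)
  rw [hfun, mvfderiv_smul (hc.mdifferentiableAt x) hΦ] at hT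
  have hu := mvfderiv_comp_sph x (mdifferentiableAt_nullVec (Φ x)) (diffeo_mdifferentiableAt Φ x) u
  have hd := lorDiff_nullVec x u
  have hd' := lorDiff_nullVec (Φ x) (mfderiv (𝓡 n) (𝓡 n) Φ x u)
  simp only [lorDiff] at hd hd'
  rw [hd, add_apply, smul_apply, hu, hd'] at hT
  refine Eq.trans hT.symm ?_
  rw [add_comm]
  rfl

/-- `Φ` is conformal with factor determined by the action of `T` on the light cone. -/
theorem HasConeFactor.roundMetric_eq_sq_mul (hc : HasConeFactor T Φ c)
    (hT : IsHyperbolicIsometry T) (x : Sph n) (u v : TangentSpace (𝓡 n) x) :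
    roundMetric x u v = c x ^ 2 *
      roundMetric (Φ x) (mfderiv (𝓡 n) (𝓡 n) Φ x u) (mfderiv (𝓡 n) (𝓡 n) Φ x v) := by
  rw [← lorentz_nullTangent, ← hT.1, hc.map_nullTangent, hc.map_nullTangent]
  simp only [lorentz_add_left, lorentz_add_right, lorentz_smul_left, lorentz_smul_right,
    lorentz_nullVec_self, lorentz_nullVec_nullTangent, lorentz_nullTangent,
    lorentz_comm (nullTangent _ _) (nullVec _)]
  ring

/-- The metric `e^{2ρ} g₀` is `Φ`-invariant exactly when `T` maps `e^{ρ(x)} (1, x)` to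
`e^{ρ(Φ x)} (1, Φ x)`. -/
theorem HasConeFactor.isMetricInvariant_iff (hn : 0 < n) (hc : HasConeFactor T Φ c)
    (hT : IsHyperbolicIsometry T) (Ω : Set (Sph n)) (ρ : Sph n → ℝ) :
    IsMetricInvariant Ω ρ Φ ↔
      ∀ x ∈ Ω, Φ x ∈ Ω → Real.exp (ρ x) * c x = Real.exp (ρ (Φ x)) := by
  have hexp (r : ℝ) : Real.exp (2 * r) = Real.exp r ^ 2 := by
    rw [← Real.exp_nat_mul]; norm_num
  refine forall₃_congr fun x _ _ => ⟨fun h => ?_, fun h u v => ?_⟩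
  · obtain ⟨u, hu⟩ := exists_roundMetric_ne_zero hn x
    have h1 := h u u
    simp only [conformalMetric, hexp] at h1
    -- Cancelling the nonzero `roundMetric` at `Φ x` leaves `(e^{ρ(x)} c(x))² = (e^{ρ(Φ x)})²`.
    rw [hc.roundMetric_eq_sq_mul hT x u u] at h1 hu
    have h2 := mul_right_cancel₀ (right_ne_zero_of_mul hu) ((mul_assoc _ _ _).trans h1)
    have hpos := (hc x).1
    refine (sq_eq_sq₀ (by positivity) (by positivity)).mp ?_
    rw [mul_pow, h2]
  · simp only [conformalMetric, hexp]
    rw [hc.roundMetric_eq_sq_mul hT x u v, ← h]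
    ring

/-! ### Invariance of hypersurfaces and metrics -/

/-- The Lorentzian product of a hypersurface with the null vector of its Gauss map. -/
theorem lorentz_hypersurface_nullVec {Ω : Set (Sph n)} {φ η : Sph n → Lor n} {ρ : Sph n → ℝ}
    (h : IsOrientedHypersurface Ω φ η) (hG : ∀ x ∈ Ω, gaussMap φ η x = (x : Euc n))
    (hρ : ∀ x ∈ Ω, supportFunction φ η x = Real.exp (ρ x)) {x : Sph n} (hx : x ∈ Ω) :
    Real.exp (ρ x) * lorentz (φ x) (nullVec x) = -1 := by
  have hψ : φ x + η x = Real.exp (ρ x) • nullVec x := by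
    have h1 : (lightCone φ η x).1 = Real.exp (ρ x) := hρ x hx
    have h2 := hG x hx
    rw [gaussMap, hρ x hx, inv_smul_eq_iff₀ (Real.exp_pos _).ne'] at h2
    refine Prod.ext ?_ ?_
    · simpa [nullVec, lightCone] using h1
    · exact h2
  rw [← lorentz_smul_right, ← hψ, lorentz_add_right, (h.mem x hx).1, lorentz_comm,
    h.normal_tangent x hx, add_zero]

/-- Invariance of the hypersurface gives the scalar relation: `φ(Φ x) = T (φ x)` has the same
nonzero product with the null vector at `Φ x` whether it is computed there or transported
from `x` by `T`. -/
theorem HasConeFactor.exp_mul_eq_of_isInvariantThrough (hc : HasConeFactor T Φ c)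
    (hT : IsHyperbolicIsometry T) {Ω : Set (Sph n)} {φ η : Sph n → Lor n} {ρ : Sph n → ℝ}
    (h : IsOrientedHypersurface Ω φ η) (hG : ∀ x ∈ Ω, gaussMap φ η x = (x : Euc n))
    (hρ : ∀ x ∈ Ω, supportFunction φ η x = Real.exp (ρ x))
    (hinv : IsInvariantThrough Ω φ T Φ) {x : Sph n} (hx : x ∈ Ω) (hΦx : Φ x ∈ Ω) :
    Real.exp (ρ x) * c x = Real.exp (ρ (Φ x)) := by
  have h1 := lorentz_hypersurface_nullVec h hG hρ hx
  have h2 := lorentz_hypersurface_nullVec h hG hρ hΦx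
  rw [← hT.1, (hc x).2, hinv x hx hΦx, lorentz_smul_right, ← mul_assoc] at h1
  refine mul_right_cancel₀ (b := lorentz (φ (Φ x)) (nullVec (Φ x))) (fun h0 => ?_)
    (h1.trans h2.symm)
  rw [h0, mul_zero] at h2
  norm_num at h2

/-- The differential of the relation `e^{ρ(z)} c(z) = e^{ρ(Φ z)}`. -/
theorem HasConeFactor.sphDiff_relation (hc : HasConeFactor T Φ c) {Ω : Set (Sph n)}
    (hΩ : IsOpen Ω) {ρ : Sph n → ℝ} (hρ : ContMDiffOn (𝓡 n) 𝓘(ℝ, ℝ) ∞ ρ Ω)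
    (hrel : ∀ x ∈ Ω, Φ x ∈ Ω → Real.exp (ρ x) * c x = Real.exp (ρ (Φ x)))
    {x : Sph n} (hx : x ∈ Ω) (hΦx : Φ x ∈ Ω) (u : TangentSpace (𝓡 n) x) :
    Real.exp (ρ x) * sphDiff c x u + c x * (Real.exp (ρ x) * sphDiff ρ x u) =
      Real.exp (ρ (Φ x)) * sphDiff ρ (Φ x) (mfderiv (𝓡 n) (𝓡 n) Φ x u) := by
  have hdiff (y : Sph n) (hy : y ∈ Ω) : MDifferentiableAt (𝓡 n) 𝓘(ℝ, ℝ) ρ y :=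
    (hρ.contMDiffAt (hΩ.mem_nhds hy)).mdifferentiableAt (by simp)
  have hdexp (y : Sph n) (hy : y ∈ Ω) :
      MDifferentiableAt (𝓡 n) 𝓘(ℝ, ℝ) (fun z => Real.exp (ρ z)) y :=
    Real.differentiable_exp.differentiableAt.mdifferentiableAt.comp y (hdiff y hy)
  have hev : (fun z => Real.exp (ρ z)) * c =ᶠ[𝓝 x] (fun z => Real.exp (ρ z)) ∘ Φ := by
    filter_upwards [hΩ.mem_nhds hx,
      Φ.contMDiff.continuous.continuousAt.preimage_mem_nhds (hΩ.mem_nhds hΦx)] with z hz hz'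
    exact hrel z hz hz'
  have hd : mvfderiv (𝓡 n) ((fun z => Real.exp (ρ z)) * c) x u =
      mvfderiv (𝓡 n) ((fun z => Real.exp (ρ z)) ∘ Φ) x u :=
    congrArg (fun L : TangentSpace (𝓡 n) x →L[ℝ] ℝ => L u) hev.mfderiv_eq
  rw [mvfderiv_comp_sph x (hdexp _ hΦx) (diffeo_mdifferentiableAt Φ x),
    mvfderiv_mul (hdexp x hx) (hc.mdifferentiableAt x)] at hd
  have e1 := sphDiff_exp (hdiff x hx) u
  have e2 := sphDiff_exp (hdiff (Φ x) hΦx) (mfderiv (𝓡 n) (𝓡 n) Φ x u)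
  simp only [sphDiff] at e1 e2 ⊢
  rw [add_apply, smul_apply,
    smul_apply, e1, e2] at hd
  exact hd

/-- The scalar relation makes the representation formula equivariant: `T (representation ρ x)` has
the square and the products that determine `representation ρ (Φ x)`. -/
theorem HasConeFactor.map_representation (hc : HasConeFactor T Φ c)
    (hT : IsHyperbolicIsometry T) {Ω : Set (Sph n)}
    (hΩ : IsOpen Ω) {ρ : Sph n → ℝ} (hρ : ContMDiffOn (𝓡 n) 𝓘(ℝ, ℝ) ∞ ρ Ω)
    (hrel : ∀ x ∈ Ω, Φ x ∈ Ω → Real.exp (ρ x) * c x = Real.exp (ρ (Φ x)))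
    {x : Sph n} (hx : x ∈ Ω) (hΦx : Φ x ∈ Ω) :
    T (representation ρ x) = representation ρ (Φ x) := by
  have hcx := (hc x).1.ne'
  have hr := hrel x hx hΦx
  have hnull : lorentz (T (representation ρ x)) (nullVec (Φ x)) = -Real.exp (-ρ (Φ x)) := by
    have h := hT.1 (representation ρ x) (nullVec x)
    rw [(hc x).2, lorentz_smul_right, lorentz_representation_nullVec, Real.exp_neg] at h
    rw [Real.exp_neg, ← hr]
    have := Real.exp_ne_zero (ρ x)
    field_simp at h ⊢
    linear_combination h
  refine eq_of_lorentz_eq (Φ x) ?_ ?_ ?_ fun w => ?_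
  · rw [hT.1, lorentz_representation_self, lorentz_representation_self]
  · rw [lorentz_representation_nullVec]
    exact neg_ne_zero.mpr (Real.exp_ne_zero _)
  · rw [hnull, lorentz_representation_nullVec]
  · obtain ⟨u, rfl⟩ : ∃ u, mfderiv (𝓡 n) (𝓡 n) Φ x u = w :=
      (Φ.mfderivToContinuousLinearEquiv (by simp) x).surjective w
    have h := hT.1 (representation ρ x) (nullTangent x u)
    have hd := hc.sphDiff_relation hΩ hρ hrel hx hΦx u
    rw [hc.map_nullTangent, lorentz_add_right, lorentz_smul_right, lorentz_smul_right, hnull,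
      lorentz_representation_nullTangent] at h
    rw [lorentz_representation_nullTangent]
    rw [Real.exp_neg, Real.exp_neg, ← hr] at h
    rw [Real.exp_neg, ← hr]
    rw [← hr] at hd
    have := Real.exp_ne_zero (ρ x)
    field_simp at h hd ⊢
    refine mul_left_cancel₀ hcx ?_
    linear_combination h + hd

end ConeFactor

end HoroConvex

end

theorem lemma3p1 (n : ℕ) (hn : 3 ≤ n) (Ω : Set (HoroConvex.Sph n)) (hΩ : IsOpen Ω)
    (Φ : Diffeomorph (𝓡 n) (𝓡 n) (HoroConvex.Sph n) (HoroConvex.Sph n) ∞)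
    (hΦ : HoroConvex.IsConformalDiffeo Φ)
    (T : HoroConvex.Lor n ≃ₗ[ℝ] HoroConvex.Lor n) (hT : HoroConvex.IsHyperbolicIsometry T)
    (hTΦ : HoroConvex.AreAssociated T Φ) :
    (∀ (φ η : HoroConvex.Sph n → HoroConvex.Lor n) (ρ : HoroConvex.Sph n → ℝ),
      HoroConvex.IsOrientedHypersurface Ω φ η →
      (∀ x ∈ Ω, HoroConvex.IsHorosphericallyConvexAt φ η x) →
      (∀ x ∈ Ω, HoroConvex.gaussMap φ η x = (x : HoroConvex.Euc n)) →
      (∀ x ∈ Ω, HoroConvex.supportFunction φ η x = Real.exp (ρ x)) →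
      HoroConvex.IsInvariantThrough Ω φ T Φ →
      HoroConvex.IsMetricInvariant Ω ρ Φ) ∧
    (∀ ρ : HoroConvex.Sph n → ℝ,
      ContMDiffOn (𝓡 n) 𝓘(ℝ, ℝ) ∞ ρ Ω →
      (∀ x ∈ Ω, ∀ c : ℝ,
        HoroConvex.IsSchoutenEigenvalue (HoroConvex.conformalMetric ρ) x c → c < 1 / 2) →
      HoroConvex.IsMetricInvariant Ω ρ Φ →
      HoroConvex.IsInvariantThrough Ω (HoroConvex.representation ρ) T Φ) := by
  have hpos : 0 < n := by omega
  obtain ⟨c, hc⟩ := hTΦ.exists_hasConeFactor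
  refine ⟨fun φ η ρ h _ hG hρ hinv => ?_, fun ρ hρ _ hinv x hx hΦx => ?_⟩
  · exact (hc.isMetricInvariant_iff hpos hT Ω ρ).mpr fun x hx hΦx =>
      hc.exp_mul_eq_of_isInvariantThrough hT h hG hρ hinv hx hΦx
  · exact hc.map_representation hT hΩ hρ ((hc.isMetricInvariant_iff hpos hT Ω ρ).mp hinv) hx hΦx
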